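/- Let $\Delta = d+1 \ge 3$ be an integer, let $\delta\in(0,1)$, and let $\lambda = (1-\delta)\lambda_c(\Delta)$, where $\lambda_c(\Delta) = \frac{(\Delta-1)^{\Delta-1}}{(\Delta-2)^{\Delta}}$. Then the function $F(x) = \frac{\lambda(1-x)^d}{1+\lambda(1-x)^d}$ has a unique fixed point $\hat x$ in $[0,1]$; it satisfies $0 < \hat x < 1/d$ and $$\frac{1+\hat x}{1-d\hat x} \;\le\; \frac{2}{\delta}\left(1+\frac{2}{d-1}\right).$$ Moreover, for every finite simple graph $G=(V,E)$ of maximum degree at most $\Delta$, the hardcore Gibbs distribution $\mu_{G,\lambda}$ satisfies $\ell_\infty$-spectral independence with constant $C = \frac{1+\hat x}{1-d\hat x}$. Here $\mu_{G,\lambda}$ is the distribution on $\{0,1\}^V$ that gives probability $\lambda^{|I|}/\sum_{J}\lambda^{|J|}$ to the indicator vector of each independent set $I$ of $G$ (the sum is over all independent sets $J$ of $G$), and probability $0$ to all other vectors. For a distribution $\mu$ on $\{0,1\}^V$, let $A_\mu$ be the set of $i\in V$ such that $\mu(\sigma_i=0)>0$ and $\mu(\sigma_i=1)>0$, and for $i,j\in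 A_\mu$ let $\Psi_\mu(i,j) = \mu(\sigma_j=1\mid\sigma_i=1)-\mu(\sigma_j=1\mid\sigma_i=0)$. The distribution $\mu$ satisfies $\ell_\infty$-spectral independence with constant $C$ if, for every $\Lambda\subseteq V$ and every $\tau\in\{0,1\}^\Lambda$ with $\mu(\sigma_\Lambda=\tau)>0$, the conditional distribution $\mu^\tau = \mu(\,\cdot\mid\sigma_\Lambda=\tau)$ satisfies $$\|\Psi_{\mu^\tau}\|_\infty := \max_{i\in A_{\mu^\tau}}\sum_{j\in A_{\mu^\tau}}|\Psi_{\mu^\tau}(i,j)|\le C,$$ where the maximum is $0$ if $A_{\mu^\tau}$ is empty. -/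

import Mathlib

open MeasureTheory ProbabilityTheory

noncomputable section

namespace Hardcore

/-! ### Influences and spectral independence of a distribution on `{0,1}^V`

A configuration is a map `σ : V → Bool`; `true` is the spin `1` and `false` the spin `0`. -/

section Influence

variable {V : Type*}

/-- The event that the spin of coordinate `i` equals `b`. -/
def spinEvent (i : V) (b : Bool) : Set (V → Bool) := {σ | σ i = b}

/-- The set `A` of unfixed coordinates of a distribution. -/
def unfixed (μ : Measure (V → Bool)) : Set V :=
  {i | 0 < μ (spinEvent i false) ∧ 0 < μ (spinEvent i true)}

/-- The influence matrix, indexed by the unfixed coordinates: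
`Ψ(i,j) = Pr[σ_j = 1 | σ_i = 1] - Pr[σ_j = 1 | σ_i = 0]`. -/
def influence (μ : Measure (V → Bool)) : Matrix (unfixed μ) (unfixed μ) ℝ :=
  fun i j =>
    (μ[|spinEvent i.1 true]).real (spinEvent j.1 true) -
      (μ[|spinEvent i.1 false]).real (spinEvent j.1 true)

open Classical in
/-- `‖Ψ‖_∞`, the maximal absolute row sum of the influence matrix (`0` if there are no unfixed
coordinates). The supremum is over a finite set, hence is a maximum. -/
def influenceNorm [Fintype V] (μ : Measure (V → Bool)) : ℝ :=
  ⨆ i : unfixed μ, ∑ j : unfixed μ, |influence μ i j|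

/-- The event that the configuration restricted to `S` equals `τ`. -/
def pinEvent (S : Set V) (τ : S → Bool) : Set (V → Bool) := {σ | ∀ v : S, σ v = τ v}

/-- `ℓ_∞`-spectral independence with constant `C`: for every pinning `τ` on every set of
coordinates with positive probability, the conditional distribution has `‖Ψ‖_∞ ≤ C`. -/
def LinftySpectralIndependence [Fintype V] (μ : Measure (V → Bool)) (C : ℝ) : Prop :=
  ∀ (S : Set V) (τ : S → Bool), 0 < μ (pinEvent S τ) → influenceNorm (μ[|pinEvent S τ]) ≤ C

end Influence

/-! ### The hardcore model -/

section Model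

variable {V : Type*} [Fintype V]

/-- The set of occupied vertices of a configuration. -/
def occupied (σ : V → Bool) : Finset V := {v | σ v = true}

open Classical in
/-- `λ^|σ|` if the occupied vertices form an independent set, and `0` otherwise. -/
def weight (G : SimpleGraph V) (lam : ℝ) (σ : V → Bool) : ℝ :=
  if G.IsIndepSet (occupied σ : Set V) then lam ^ (occupied σ).card else 0

open Classical in
/-- The partition function `Z_{G,λ}`. -/
def partitionFunction (G : SimpleGraph V) (lam : ℝ) : ℝ := ∑ σ : V → Bool, weight G lam σ

open Classical in
/-- The hardcore Gibbs distribution `μ_{G,λ}` on `{0,1}^V`. -/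
def gibbs (G : SimpleGraph V) (lam : ℝ) : Measure (V → Bool) :=
  ∑ σ : V → Bool, ENNReal.ofReal (weight G lam σ / partitionFunction G lam) • Measure.dirac σ

end Model

/-- The tree-uniqueness threshold `λ_c(Δ) = (Δ-1)^(Δ-1) / (Δ-2)^Δ`, for `Δ ≥ 3`. -/
def criticalFugacity (Δ : ℕ) : ℝ := ((Δ : ℝ) - 1) ^ (Δ - 1) / ((Δ : ℝ) - 2) ^ Δ

/-- The tree recursion `F_{d,λ}(x) = λ(1-x)^d / (1 + λ(1-x)^d)`. -/
def treeRecursion (d : ℕ) (lam x : ℝ) : ℝ := lam * (1 - x) ^ d / (1 + lam * (1 - x) ^ d)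

end Hardcore

end

noncomputable section

namespace Hardcore

/-! ### Scalar estimates -/

section Scalar

/-! A pinning reduces the model to the hardcore model on the free vertices `U`. There, occupying `r`
leaves the model on `delNbhd G U r`, emptying it the model on `U.erase r`, and the two differ by
deleting the neighbours of `r`. Delete them one at a time: removing `v` from `W` moves the marginals
by `occ W v` times the influences of `v` in `W` (`occ_erase_sub`). Since `r` is already gone, `v`
has at most `d` neighbours in `W`, so the argument recurses on smaller vertex sets without a
self-avoiding walk tree.

The quantity that recurses is marginal times total influence, with invariant bound `min x p / (1 - d
x)`, where `p` is the marginal and `x` the fixed point. Its preservation (`tree_step`) is an AM-GM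
inequality balanced at `x`, where `lam (1 - x)^(d+1) = x`. The initial vertex may have `d + 1`
neighbours, which gives `1 + (d+1) x / (1 - d x) = (1 + x) / (1 - d x)`. -/

lemma one_sub_le_mul_exp {x q : ℝ} (hx : x < 1) :
    1 - q ≤ (1 - x) * Real.exp ((x - q) / (1 - x)) := by
  have h1 : 0 < 1 - x := by linarith
  have := mul_le_mul_of_nonneg_left (Real.add_one_le_exp ((x - q) / (1 - x))) h1.le
  have h2 : (1 - x) * ((x - q) / (1 - x) + 1) = 1 - q := by field_simp; ring
  linarith

/-- An instance of the inequality between arithmetic and geometric means, for `d + 1` factors whose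
sum is `(d + 1) (1 - x)`. -/
lemma prod_one_sub_mul_le {ι : Type*} (s : Finset ι) (q : ι → ℝ) {d : ℕ} {x : ℝ}
    (hx : x < 1) (hs : s.card ≤ d) (hq : ∀ v ∈ s, q v ≤ 1) :
    (∏ v ∈ s, (1 - q v)) * (1 - x - d * x + ∑ v ∈ s, q v) ≤ (1 - x) ^ (d + 1) := by
  have h1 : 0 < 1 - x := by linarith
  have hP : 0 ≤ ∏ v ∈ s, (1 - q v) := Finset.prod_nonneg fun v hv => by linarith [hq v hv]
  have hprod : ∏ v ∈ s, (1 - q v) ≤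
      (1 - x) ^ s.card * Real.exp (∑ v ∈ s, (x - q v) / (1 - x)) := by
    rw [Real.exp_sum, ← Finset.prod_const, ← Finset.prod_mul_distrib]
    exact Finset.prod_le_prod (fun v hv => by linarith [hq v hv])
      fun v _ => one_sub_le_mul_exp hx
  -- The extra AM-GM factor has the form `1 - q` too. It may be negative, which is harmless: the
  -- tangent-line bound holds for every real `q`.
  have hlast : 1 - x - d * x + ∑ v ∈ s, q v ≤
      (1 - x) * Real.exp ((∑ v ∈ s, q v - d * x) / (1 - x)) := by
    have := one_sub_le_mul_exp (q := x + d * x - ∑ v ∈ s, q v) hx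
    convert this using 1
    · ring
    · congr 3; ring
  obtain ⟨k, rfl⟩ := Nat.exists_eq_add_of_le hs
  -- The `k` factors missing when `s` has fewer than `d` elements count as `1`, the case `q = 0`.
  have hone : (1 : ℝ) ≤ ((1 - x) * Real.exp (x / (1 - x))) ^ k :=
    one_le_pow₀ (by simpa using one_sub_le_mul_exp (q := 0) hx)
  have hE : 0 ≤ (1 - x) * Real.exp ((∑ v ∈ s, q v - ((s.card + k : ℕ) : ℝ) * x) / (1 - x)) := by
    positivity
  calc _ ≤ (∏ v ∈ s, (1 - q v)) *
        ((1 - x) * Real.exp ((∑ v ∈ s, q v - ((s.card + k : ℕ) : ℝ) * x) / (1 - x))) :=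
        mul_le_mul_of_nonneg_left hlast hP
    _ ≤ ((1 - x) ^ s.card * Real.exp (∑ v ∈ s, (x - q v) / (1 - x))) *
        ((1 - x) * Real.exp ((∑ v ∈ s, q v - ((s.card + k : ℕ) : ℝ) * x) / (1 - x))) :=
        mul_le_mul_of_nonneg_right hprod hE
    _ ≤ ((1 - x) ^ s.card * Real.exp (∑ v ∈ s, (x - q v) / (1 - x))) *
        ((1 - x) * Real.exp ((∑ v ∈ s, q v - ((s.card + k : ℕ) : ℝ) * x) / (1 - x))) *
        ((1 - x) * Real.exp (x / (1 - x))) ^ k :=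
        le_mul_of_one_le_right (by positivity) hone
    _ = (1 - x) ^ (s.card + k + 1) * Real.exp (∑ v ∈ s, (x - q v) / (1 - x) +
        (∑ v ∈ s, q v - ((s.card + k : ℕ) : ℝ) * x) / (1 - x) + k * (x / (1 - x))) := by
        rw [Real.exp_add, Real.exp_add, Real.exp_nat_mul, mul_pow]; ring
    _ = (1 - x) ^ (s.card + k + 1) := by
        have : ∑ v ∈ s, (x - q v) / (1 - x) +
            (∑ v ∈ s, q v - ((s.card + k : ℕ) : ℝ) * x) / (1 - x) + k * (x / (1 - x)) = 0 := by
          rw [← Finset.sum_div, Finset.sum_sub_distrib, Finset.sum_const, nsmul_eq_mul]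
          push_cast; ring
        rw [this, Real.exp_zero, mul_one]

/-- The invariant `p ↦ min x p / (1 - d x)` is preserved by the tree recursion. -/
lemma tree_step {ι : Type*} (s : Finset ι) (q : ι → ℝ) {d : ℕ} {x lam p : ℝ}
    (hx0 : 0 < x) (hx1 : x < 1) (hdx : d * x < 1) (hlam : lam * (1 - x) ^ (d + 1) = x)
    (hs : s.card ≤ d) (hq : ∀ v ∈ s, q v ≤ 1)
    (hp : p * (1 + lam * ∏ v ∈ s, (1 - q v)) = lam * ∏ v ∈ s, (1 - q v)) :
    p * (1 + ∑ v ∈ s, min x (q v) / (1 - d * x)) ≤ min x p / (1 - d * x) := by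
  have h1 : 0 < 1 - x := by linarith
  have hD : 0 < 1 - d * x := by linarith
  have hl : 0 < lam := by
    by_contra h
    have : lam * (1 - x) ^ (d + 1) ≤ 0 := mul_nonpos_of_nonpos_of_nonneg (by linarith) (by positivity)
    linarith
  set P := ∏ v ∈ s, (1 - q v) with hPdef
  set Q := ∏ v ∈ s, (1 - min x (q v)) with hQdef
  have hP : 0 ≤ P := Finset.prod_nonneg fun v hv => by linarith [hq v hv]
  have hPQ : P ≤ Q := Finset.prod_le_prod (fun v hv => by linarith [hq v hv])
    fun v _ => by linarith [min_le_right x (q v)]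
  have hlP : 0 ≤ lam * P := by positivity
  have hp0 : 0 ≤ p := by
    by_contra h
    nlinarith
  set M := ∑ v ∈ s, min x (q v) with hM
  have hMle : M ≤ d * x := by
    calc M ≤ ∑ v ∈ s, x := Finset.sum_le_sum fun v _ => min_le_left _ _
      _ = s.card * x := by simp
      _ ≤ d * x := by gcongr
  have key : Q * (1 - x - d * x + M) ≤ (1 - x) ^ (d + 1) :=
    prod_one_sub_mul_le s (fun v => min x (q v)) hx1 hs fun v hv => (min_le_right _ _).trans (hq v hv)
  -- Replacing `Q` by the smaller `P` needs a nonnegative second factor; otherwise the left side is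
  -- nonpositive anyway.
  have key2 : P * (1 - x - d * x + M) ≤ (1 - x) ^ (d + 1) := by
    rcases le_total 0 (1 - x - d * x + M) with h | h
    · exact (mul_le_mul_of_nonneg_right hPQ h).trans key
    · exact (mul_nonpos_of_nonneg_of_nonpos hP h).trans (by positivity)
  rw [← Finset.sum_div, ← hM]
  have : p * (1 + M / (1 - d * x)) = p * (1 - d * x + M) / (1 - d * x) := by field_simp
  rw [this]
  -- After multiplication by `1 + lam P`, the bound by `x` becomes `key2` times `lam`; the bound by
  -- `p` is `M ≤ d x`, which is why the marginals are capped at `x`.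
  refine div_le_div_of_nonneg_right (le_min ?_ ?_) hD.le
  · have h3 : lam * (P * (1 - x - d * x + M)) ≤ x :=
      (mul_le_mul_of_nonneg_left key2 hl.le).trans hlam.le
    have h4 : p * (1 - d * x + M) * (1 + lam * P) ≤ x * (1 + lam * P) := by
      calc _ = (p * (1 + lam * P)) * (1 - d * x + M) := by ring
        _ = lam * (P * (1 - x - d * x + M)) + x * (lam * P) := by rw [hp]; ring
        _ ≤ _ := by linarith
    exact le_of_mul_le_mul_right h4 (by linarith)
  · nlinarith

/-! ### The fixed point and the size of the constant. -/

lemma treeRecursion_eq_iff {d : ℕ} {lam y : ℝ} (hl : 0 < lam) (hy : y ≤ 1) :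
    treeRecursion d lam y = y ↔ lam * (1 - y) ^ (d + 1) = y := by
  have h : 0 ≤ lam * (1 - y) ^ d := mul_nonneg hl.le (pow_nonneg (by linarith) _)
  unfold treeRecursion
  rw [div_eq_iff (by linarith), pow_succ]
  constructor <;> intro h <;> linarith

lemma criticalFugacity_succ (d : ℕ) :
    criticalFugacity (d + 1) = (d : ℝ) ^ d / ((d : ℝ) - 1) ^ (d + 1) := by
  simp only [criticalFugacity, Nat.add_sub_cancel]
  push_cast
  congr 2 <;> ring

lemma exists_fixedPoint {d : ℕ} (hd : 2 ≤ d) {lam : ℝ} (hl : 0 < lam)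
    (hlc : lam < criticalFugacity (d + 1)) :
    ∃ x ∈ Set.Ioo (0 : ℝ) (1 / (d : ℝ)), lam * (1 - x) ^ (d + 1) = x := by
  have hd' : (2 : ℝ) ≤ d := by exact_mod_cast hd
  have hcont : ContinuousOn (fun x : ℝ => x - lam * (1 - x) ^ (d + 1)) (Set.Icc 0 (1 / (d : ℝ))) := by
    fun_prop
  have hmem : (0 : ℝ) ∈ Set.Ioo ((fun x : ℝ => x - lam * (1 - x) ^ (d + 1)) 0)
      ((fun x : ℝ => x - lam * (1 - x) ^ (d + 1)) (1 / (d : ℝ))) := by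
    refine ⟨by simpa using hl, ?_⟩
    -- The critical fugacity is the one whose fixed point is exactly `1 / d`; below it the sign at
    -- `1 / d` is strict.
    rw [criticalFugacity_succ, lt_div_iff₀ (pow_pos (by linarith) _)] at hlc
    have h1 : (1 - 1 / (d : ℝ)) ^ (d + 1) = (d - 1 : ℝ) ^ (d + 1) / d ^ (d + 1) := by
      rw [← div_pow]; congr 1; field_simp
    have h2 : lam * ((d - 1 : ℝ) ^ (d + 1) / d ^ (d + 1)) < 1 / d := by
      rw [← mul_div_assoc, div_lt_div_iff₀ (by positivity) (by positivity), pow_succ (d : ℝ) d]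
      nlinarith
    simp only [h1]; linarith
  obtain ⟨x, hx, hx0⟩ := intermediate_value_Ioo (by positivity) hcont hmem
  exact ⟨x, hx, by linarith⟩

/-- On `y ≤ 1` the left side of the fixed-point equation is nonincreasing while the right side
strictly increases. -/
lemma fixedPoint_unique {d : ℕ} {lam x y : ℝ} (hl : 0 < lam) (hx : x ≤ 1) (hy : y ≤ 1)
    (hfx : lam * (1 - x) ^ (d + 1) = x) (hfy : lam * (1 - y) ^ (d + 1) = y) : y = x := by
  have aux : ∀ {a b : ℝ}, b ≤ 1 → lam * (1 - a) ^ (d + 1) = a →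
      lam * (1 - b) ^ (d + 1) = b → ¬ a < b := by
    intro a b hb ha' hb' hab
    have : (1 - b) ^ (d + 1) ≤ (1 - a) ^ (d + 1) := pow_le_pow_left₀ (by linarith) (by linarith) _
    nlinarith
  exact le_antisymm (not_lt.1 (aux hy hfx hfy)) (not_lt.1 (aux hx hfy hfx))

/-- Solving the fixed-point equation for `1 - δ` gives a power of `1 - t` with `t = (1 - d x) / (d
(1 - x))`. Bernoulli's inequality then bounds `δ` by a multiple of `1 - d x`, and `d x < 1` controls
the remaining factors. -/
lemma constant_le {d : ℕ} (hd : 2 ≤ d) {δ lam x : ℝ} (hδ0 : 0 < δ)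
    (hlam : lam = (1 - δ) * criticalFugacity (d + 1)) (hx : x ∈ Set.Ioo (0 : ℝ) (1 / (d : ℝ)))
    (hfx : lam * (1 - x) ^ (d + 1) = x) :
    (1 + x) / (1 - (d : ℝ) * x) ≤ 2 / δ * (1 + 2 / ((d : ℝ) - 1)) := by
  have hd' : (2 : ℝ) ≤ d := by exact_mod_cast hd
  have hx0 := hx.1
  have hdx : d * x < 1 := by
    have := hx.2
    rw [lt_div_iff₀ (by positivity)] at this
    linarith
  have hx1 : 0 < 1 - x := by nlinarith
  have hd1 : (0 : ℝ) < d - 1 := by linarith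
  have hratio : 1 - δ = d * x * ((d - 1) / (d * (1 - x))) ^ (d + 1) := by
    rw [hlam, criticalFugacity_succ] at hfx
    have hfx' : (1 - δ) * ((d : ℝ) ^ d * (1 - x) ^ (d + 1)) = x * (d - 1) ^ (d + 1) := by
      have h := congrArg (· * (d - 1 : ℝ) ^ (d + 1)) hfx
      rw [← h]; field_simp
    rw [div_pow, mul_pow, ← mul_div_assoc, eq_div_iff (by positivity), pow_succ (d : ℝ) d]
    linear_combination (d : ℝ) * hfx'
  have hbern : 1 - (d + 1) * ((1 - d * x) / (d * (1 - x))) ≤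
      ((d - 1) / (d * (1 - x))) ^ (d + 1) := by
    have h1 : (-2 : ℝ) ≤ -((1 - d * x) / (d * (1 - x))) := by
      rw [neg_le_neg_iff, div_le_iff₀ (by positivity)]
      nlinarith
    have h2 := one_add_mul_le_pow h1 (d + 1)
    have h3 : (1 : ℝ) + -((1 - d * x) / (d * (1 - x))) = (d - 1) / (d * (1 - x)) := by
      field_simp; ring
    rw [h3] at h2
    push_cast at h2
    linarith
  have hδ : δ ≤ (1 - d * x) * ((1 + d * x) / (1 - x)) := by
    have h4 := mul_le_mul_of_nonneg_left hbern (show 0 ≤ d * x by positivity)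
    rw [← hratio] at h4
    have h5 : d * x * (1 - (d + 1) * ((1 - d * x) / (d * (1 - x)))) =
        1 - (1 - d * x) * ((1 + d * x) / (1 - x)) := by
      field_simp; ring
    linarith
  have hmono : (1 + d * x) / (1 - x) * ((1 + x) * (d - 1)) ≤ 2 * (d + 1) := by
    rw [div_mul_eq_mul_div, div_le_iff₀ hx1]
    -- Uses `1 + d x ≤ 2`; what then remains is `(1 + x)(d - 1) ≤ (d + 1)(1 - x)`, again `d x ≤ 1`.
    have h6 : (1 + d * x) * (1 + x) * (d - 1) ≤ 2 * ((1 + x) * (d - 1)) := by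
      nlinarith [mul_pos (show 0 < 1 + x by linarith) hd1]
    nlinarith
  have hrhs : 2 / δ * (1 + 2 / ((d : ℝ) - 1)) = 2 * (d + 1) / (δ * (d - 1)) := by
    field_simp; ring
  rw [hrhs, div_le_div_iff₀ (by linarith) (by positivity)]
  calc (1 + x) * (δ * (d - 1)) = δ * ((1 + x) * (d - 1)) := by ring
    _ ≤ (1 - d * x) * ((1 + d * x) / (1 - x)) * ((1 + x) * (d - 1)) :=
        mul_le_mul_of_nonneg_right hδ (mul_nonneg (by linarith) hd1.le)
    _ = (1 - d * x) * ((1 + d * x) / (1 - x) * ((1 + x) * (d - 1))) := by ring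
    _ ≤ (1 - d * x) * (2 * (d + 1)) := mul_le_mul_of_nonneg_left hmono (by linarith)
    _ = _ := by ring

end Scalar

/-! ### The hardcore model on induced subgraphs -/

section Induced

variable {V : Type*} (G : SimpleGraph V) (lam : ℝ)

open Classical in
/-- The weighted sum of `f` over the independent sets contained in `U`. -/
def indepSum (U : Finset V) (f : Finset V → ℝ) : ℝ :=
  ∑ I ∈ U.powerset.filter (fun I : Finset V => G.IsIndepSet (I : Set V)), lam ^ I.card * f I

/-- The partition function of the subgraph induced on `U`. -/
def subZ (U : Finset V) : ℝ := indepSum G lam U fun _ => 1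

open Classical in
/-- The probability that `j` is occupied in the hardcore model on the subgraph induced on `U`. -/
def occ (U : Finset V) (j : V) : ℝ :=
  indepSum G lam U (fun I => if j ∈ I then 1 else 0) / subZ G lam U

open Classical in
/-- The vertices of `U` outside the closed neighbourhood of `v`. -/
def delNbhd (U : Finset V) (v : V) : Finset V := {w ∈ U.erase v | ¬ G.Adj v w}

open Classical in
/-- The influence of `v` on `j` in the hardcore model on the subgraph induced on `U`. -/
def subInfluence (U : Finset V) (v j : V) : ℝ :=
  (if j = v then 1 else occ G lam (delNbhd G U v) j) - occ G lam (U.erase v) j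

variable {G lam}

open Classical in
lemma sum_indep_mem {U : Finset V} {v : V} (hv : v ∈ U) (f : Finset V → ℝ) :
    indepSum G lam U (fun I => if v ∈ I then f I else 0) =
      lam * indepSum G lam (delNbhd G U v) (fun I => f (insert v I)) := by
  unfold indepSum
  rw [Finset.mul_sum]
  simp only [mul_ite, mul_zero]
  rw [← Finset.sum_filter, Finset.filter_filter]
  refine Finset.sum_nbij' (fun I => I.erase v) (fun I => insert v I) ?_ ?_ ?_ ?_ ?_
  · intro I hI
    simp only [Finset.mem_filter, Finset.mem_powerset] at hI ⊢
    obtain ⟨hIU, hI, hvI⟩ := hI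
    refine ⟨fun w hw => ?_, fun a ha b hb => hI (Finset.mem_of_mem_erase ha)
      (Finset.mem_of_mem_erase hb)⟩
    have hw' := Finset.mem_erase.1 hw
    simp only [delNbhd, Finset.mem_filter, Finset.mem_erase]
    exact ⟨⟨hw'.1, hIU hw'.2⟩, hI hvI hw'.2 hw'.1.symm⟩
  · intro I hI
    simp only [Finset.mem_filter, Finset.mem_powerset] at hI ⊢
    obtain ⟨hIU, hI⟩ := hI
    have hIU' : ∀ w ∈ I, (w ≠ v ∧ w ∈ U) ∧ ¬ G.Adj v w := by
      intro w hw
      simpa [delNbhd] using hIU hw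
    refine ⟨?_, ?_, Finset.mem_insert_self _ _⟩
    · intro w hw
      rcases Finset.mem_insert.1 hw with rfl | hw
      · exact hv
      · exact (hIU' w hw).1.2
    · intro a ha b hb hab
      rcases Finset.mem_insert.1 (Finset.mem_coe.1 ha) with rfl | ha'
      · rcases Finset.mem_insert.1 (Finset.mem_coe.1 hb) with rfl | hb'
        · exact absurd rfl hab
        · exact (hIU' b hb').2
      · rcases Finset.mem_insert.1 (Finset.mem_coe.1 hb) with rfl | hb'
        · exact fun h => (hIU' a ha').2 h.symm
        · exact hI ha' hb' hab
  · intro I hI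
    simp only [Finset.mem_filter] at hI
    exact Finset.insert_erase hI.2.2
  · intro I hI
    simp only [Finset.mem_filter, Finset.mem_powerset] at hI
    refine Finset.erase_insert fun h => ?_
    simpa [delNbhd] using hI.1 h
  · intro I hI
    simp only [Finset.mem_filter] at hI
    rw [Finset.insert_erase hI.2.2, ← Finset.card_erase_add_one hI.2.2, pow_succ]
    ring

open Classical in
lemma sum_indep_notMem (U : Finset V) (v : V) (f : Finset V → ℝ) :
    indepSum G lam U (fun I => if v ∈ I then 0 else f I) = indepSum G lam (U.erase v) f := by
  unfold indepSum
  have h : ∀ I : Finset V, lam ^ I.card * (if v ∈ I then 0 else f I) =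
      if v ∉ I then lam ^ I.card * f I else 0 := by
    intro I; split_ifs <;> simp_all
  simp only [h]
  rw [← Finset.sum_filter, Finset.filter_filter]
  congr 1
  ext I
  simp only [Finset.mem_filter, Finset.mem_powerset, Finset.subset_erase]
  tauto

open Classical in
lemma indepSum_split {U : Finset V} {v : V} (hv : v ∈ U) (f : Finset V → ℝ) :
    indepSum G lam U f = indepSum G lam (U.erase v) f +
      lam * indepSum G lam (delNbhd G U v) (fun I => f (insert v I)) := by
  rw [← sum_indep_mem hv, ← sum_indep_notMem]
  unfold indepSum
  rw [← Finset.sum_add_distrib]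
  refine Finset.sum_congr rfl fun I _ => ?_
  by_cases h : v ∈ I <;> simp [h]

lemma subZ_pos (hl : 0 < lam) (U : Finset V) : 0 < subZ G lam U := by
  classical
  unfold subZ indepSum
  refine Finset.sum_pos (fun I _ => by positivity) ⟨∅, by simp [SimpleGraph.IsIndepSet]⟩

open Classical in
lemma subZ_split {U : Finset V} {v : V} (hv : v ∈ U) :
    subZ G lam U = subZ G lam (U.erase v) + lam * subZ G lam (delNbhd G U v) := by
  exact indepSum_split hv _

lemma occ_nonneg (hl : 0 < lam) (U : Finset V) (j : V) : 0 ≤ occ G lam U j := by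
  classical
  refine div_nonneg (Finset.sum_nonneg fun I _ => ?_) (subZ_pos hl U).le
  positivity

lemma occ_le_one (hl : 0 < lam) (U : Finset V) (j : V) : occ G lam U j ≤ 1 := by
  classical
  refine div_le_one_of_le₀ (Finset.sum_le_sum fun I _ => ?_) (subZ_pos hl U).le
  refine mul_le_mul_of_nonneg_left ?_ (by positivity)
  by_cases h : j ∈ I <;> simp [h]

lemma occ_of_notMem {U : Finset V} {j : V} (hj : j ∉ U) : occ G lam U j = 0 := by
  classical
  unfold occ indepSum
  rw [Finset.sum_eq_zero, zero_div]
  intro I hI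
  have h : j ∉ I := fun h => hj (Finset.mem_powerset.1 (Finset.mem_filter.1 hI).1 h)
  simp [h]

lemma occ_self {U : Finset V} {v : V} (hv : v ∈ U) :
    occ G lam U v = lam * subZ G lam (delNbhd G U v) / subZ G lam U := by
  classical
  have := sum_indep_mem (G := G) (lam := lam) hv (fun _ => 1)
  rw [occ, this, subZ, subZ]

/-! ### Vertex deletion and the influence recursion. -/

open Classical in
/-- Deleting a vertex changes the occupation probabilities according to its influence. -/
lemma occ_erase_sub (hl : 0 < lam) {U : Finset V} {v : V} (hv : v ∈ U) (j : V) :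
    occ G lam (U.erase v) j - occ G lam U j = -(occ G lam U v * subInfluence G lam U v j) := by
  have hZ := subZ_pos (G := G) hl U
  have hZ1 := subZ_pos (G := G) hl (U.erase v)
  have hZ2 := subZ_pos (G := G) hl (delNbhd G U v)
  have hsplit := subZ_split (G := G) (lam := lam) hv
  have hN := indepSum_split (G := G) (lam := lam) hv (fun I => if j ∈ I then 1 else 0)
  -- Total probability over the state of `v`, with denominators cleared.
  have hocc : occ G lam U j * subZ G lam U =
      occ G lam (U.erase v) j * subZ G lam (U.erase v) + lam * subZ G lam (delNbhd G U v) *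
        (if j = v then 1 else occ G lam (delNbhd G U v) j) := by
    have e : ∀ W, occ G lam W j * subZ G lam W =
        indepSum G lam W (fun I => if j ∈ I then 1 else 0) := fun W =>
      div_mul_cancel₀ _ (subZ_pos hl W).ne'
    rw [e, hN]
    congr 1
    · exact (e _).symm
    · split_ifs with h
      · subst h; simp [subZ]
      · rw [mul_assoc, mul_comm (subZ _ _ _), e]
        simp [Finset.mem_insert, h]
  have hself : occ G lam U v * subZ G lam U = lam * subZ G lam (delNbhd G U v) := by
    rw [occ_self hv]; exact div_mul_cancel₀ _ hZ.ne'
  have hI : subInfluence G lam U v j =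
      (if j = v then 1 else occ G lam (delNbhd G U v) j) - occ G lam (U.erase v) j := by
    unfold subInfluence; congr!
  rw [hI]
  generalize (if j = v then 1 else occ G lam (delNbhd G U v) j) = t at *
  apply mul_right_cancel₀ hZ.ne'
  linear_combination (occ G lam (U.erase v) j) * hsplit - hocc +
    (t - occ G lam (U.erase v) j) * hself

open Classical in
lemma subZ_erase (hl : 0 < lam) {U : Finset V} {v : V} (hv : v ∈ U) :
    subZ G lam (U.erase v) = (1 - occ G lam U v) * subZ G lam U := by
  have hZ := subZ_pos (G := G) hl U
  rw [occ_self hv, sub_mul, div_mul_cancel₀ _ hZ.ne', subZ_split hv]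
  ring

open Classical in
/-- Telescoping along the successive deletion of the vertices of `s`. -/
lemma exists_telescope [Fintype V] (hl : 0 < lam) (g : ℝ → ℝ) (W s : Finset V) (hsW : s ⊆ W)
    (hg : ∀ v ∈ s, ∀ W' ⊆ W, v ∈ W' →
      occ G lam W' v * ∑ j, |subInfluence G lam W' v j| ≤ g (occ G lam W' v)) :
    ∃ q : V → ℝ, (∀ v, q v ≤ 1) ∧
      subZ G lam (W \ s) = (∏ v ∈ s, (1 - q v)) * subZ G lam W ∧
      ∑ j, |occ G lam (W \ s) j - occ G lam W j| ≤ ∑ v ∈ s, g (q v) := by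
  induction s using Finset.induction_on with
  | empty => exact ⟨fun _ => 0, by simp, by simp, by simp⟩
  | insert v s hvs ih =>
    obtain ⟨q, hq, hZ, hsum⟩ := ih ((Finset.subset_insert _ _).trans hsW)
      fun w hw => hg w (Finset.mem_insert_of_mem hw)
    have hv : v ∈ W \ s := Finset.mem_sdiff.2 ⟨hsW (Finset.mem_insert_self _ _), hvs⟩
    have herase : W \ insert v s = (W \ s).erase v := by
      rw [Finset.sdiff_insert]
    have hq' : ∀ w ∈ s, Function.update q v (occ G lam (W \ s) v) w = q w := fun w hw =>
      Function.update_of_ne (ne_of_mem_of_not_mem hw hvs) _ _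
    -- `q v` records the marginal of `v` at the moment of its deletion, so the product of the `1 - q
    -- v` is the chain rule for the probability that `s` is empty.
    refine ⟨Function.update q v (occ G lam (W \ s) v), ?_, ?_, ?_⟩
    · intro w
      by_cases h : w = v
      · subst h; simpa using occ_le_one hl _ _
      · simpa [h] using hq w
    · rw [Finset.prod_insert hvs, Finset.prod_congr rfl fun w hw => by rw [hq' w hw],
        Function.update_self, herase, subZ_erase hl hv, hZ]
      ring
    · rw [Finset.sum_insert hvs,
        Finset.sum_congr rfl fun w (hw : w ∈ s) => congrArg g (hq' w hw), Function.update_self, herase]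
      have h1 := hg v (Finset.mem_insert_self _ _) (W \ s) Finset.sdiff_subset hv
      calc _ ≤ ∑ j, (|occ G lam ((W \ s).erase v) j - occ G lam (W \ s) j| +
            |occ G lam (W \ s) j - occ G lam W j|) :=
            Finset.sum_le_sum fun j _ => abs_sub_le _ _ _
        _ = occ G lam (W \ s) v * ∑ j, |subInfluence G lam (W \ s) v j| +
            ∑ j, |occ G lam (W \ s) j - occ G lam W j| := by
            rw [Finset.sum_add_distrib, Finset.mul_sum]
            congr 1
            refine Finset.sum_congr rfl fun j _ => ?_
            rw [occ_erase_sub hl hv, abs_neg, abs_mul, abs_of_nonneg (occ_nonneg hl _ _)]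
        _ ≤ _ := add_le_add h1 hsum

open Classical in
/-- The recursion for the total influence of a vertex, in terms of its neighbours. -/
lemma exists_recursion [Fintype V] (hl : 0 < lam) (g : ℝ → ℝ) {U : Finset V} {r : V} (hr : r ∈ U)
    (hg : ∀ v, G.Adj r v → ∀ W' ⊆ U.erase r, v ∈ W' →
      occ G lam W' v * ∑ j, |subInfluence G lam W' v j| ≤ g (occ G lam W' v)) :
    ∃ q : V → ℝ, (∀ v, q v ≤ 1) ∧
      occ G lam U r * (1 + lam * ∏ v ∈ U with G.Adj r v, (1 - q v)) =
        lam * ∏ v ∈ U with G.Adj r v, (1 - q v) ∧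
      ∑ j, |subInfluence G lam U r j| ≤ 1 + ∑ v ∈ U with G.Adj r v, g (q v) := by
  have hsub : ({v ∈ U | G.Adj r v} : Finset V) ⊆ U.erase r := by
    intro v hv
    rw [Finset.mem_filter] at hv
    exact Finset.mem_erase.2 ⟨hv.2.ne', hv.1⟩
  obtain ⟨q, hq, hZ, hsum⟩ := exists_telescope hl g (U.erase r) {v ∈ U | G.Adj r v} hsub
    fun v hv => hg v (Finset.mem_filter.1 hv).2
  have hdel : U.erase r \ ({v ∈ U | G.Adj r v} : Finset V) = delNbhd G U r := by
    ext w
    simp only [delNbhd, Finset.mem_sdiff, Finset.mem_filter, Finset.mem_erase]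
    tauto
  rw [hdel] at hZ hsum
  refine ⟨q, hq, ?_, ?_⟩
  · have hsplit := subZ_split (G := G) (lam := lam) hr
    have h1 := subZ_pos (G := G) hl (U.erase r)
    have h2 := subZ_pos (G := G) hl U
    have hself : occ G lam U r * subZ G lam U = lam * subZ G lam (delNbhd G U r) := by
      rw [occ_self hr]; exact div_mul_cancel₀ _ h2.ne'
    rw [hsplit, hZ] at hself
    apply mul_right_cancel₀ h1.ne'
    linear_combination hself
  · calc _ ≤ ∑ j, ((if j = r then 1 else 0) +
          |occ G lam (delNbhd G U r) j - occ G lam (U.erase r) j|) := by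
          refine Finset.sum_le_sum fun j _ => ?_
          unfold subInfluence
          -- The diagonal term is exactly `1`, since `r` has marginal `0` once deleted.
          split_ifs with h
          · subst h
            rw [occ_of_notMem (U := U.erase j) (by simp)]
            simp
          · rw [zero_add]
      _ = 1 + ∑ j, |occ G lam (delNbhd G U r) j - occ G lam (U.erase r) j| := by
          rw [Finset.sum_add_distrib]; simp
      _ ≤ _ := by linarith

open Classical in
/-- The total influence of a vertex with at most `d` neighbours, times its occupation
probability. -/
lemma occ_mul_sum_le [Fintype V] {d : ℕ} {x : ℝ} (hl : 0 < lam)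
    (hx0 : 0 < x) (hx1 : x < 1) (hdx : d * x < 1) (hlam : lam * (1 - x) ^ (d + 1) = x)
    (hdeg : ∀ v, (Finset.univ.filter (G.Adj v)).card ≤ d + 1) (n : ℕ) :
    ∀ (U : Finset V), U.card = n → ∀ r ∈ U, ({v ∈ U | G.Adj r v} : Finset V).card ≤ d →
      occ G lam U r * ∑ j, |subInfluence G lam U r j| ≤ min x (occ G lam U r) / (1 - d * x) := by
  induction n using Nat.strong_induction_on with
  | _ n ih =>
    intro U hU r hr hcard
    obtain ⟨q, hq, hp, hsum⟩ := exists_recursion (G := G) hl (fun p => min x p / (1 - d * x)) hr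
      (fun v hrv W' hW' hv => by
        have hcardW : W'.card < n := by
          rw [← hU]
          exact (Finset.card_le_card hW').trans_lt (Finset.card_erase_lt_of_mem hr)
        refine ih _ hcardW W' rfl v hv ?_
        -- `r` is a neighbour of `v` outside `W'`, so the degree bound drops from `d + 1` to `d`.
        have hlt : ({w ∈ W' | G.Adj v w} : Finset V) ⊂ Finset.univ.filter (G.Adj v) := by
          refine (Finset.ssubset_iff_of_subset
            (Finset.filter_subset_filter _ (Finset.subset_univ _))).2 ⟨r, ?_, ?_⟩
          · simpa using hrv.symm
          · intro h
            have := hW' (Finset.mem_filter.1 h).1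
            simp at this
        have := Finset.card_lt_card hlt
        have := hdeg v
        omega)
    refine (mul_le_mul_of_nonneg_left hsum (occ_nonneg hl _ _)).trans ?_
    exact tree_step _ q hx0 hx1 hdx hlam hcard (fun v _ => hq v) hp

-- The initial vertex has lost no neighbour, hence up to `d + 1` summands, each at most `x / (1 - d
-- x)`; all later vertices fall under `occ_mul_sum_le`.
open Classical in
lemma sum_abs_subInfluence_le [Fintype V] {d : ℕ} {x : ℝ} (hl : 0 < lam)
    (hx0 : 0 < x) (hx1 : x < 1) (hdx : d * x < 1) (hlam : lam * (1 - x) ^ (d + 1) = x)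
    (hdeg : ∀ v, (Finset.univ.filter (G.Adj v)).card ≤ d + 1) {U : Finset V} {r : V} (hr : r ∈ U) :
    ∑ j, |subInfluence G lam U r j| ≤ (1 + x) / (1 - d * x) := by
  have hD : 0 < 1 - d * x := by linarith
  obtain ⟨q, hq, hp, hsum⟩ := exists_recursion (G := G) hl (fun p => min x p / (1 - d * x)) hr
    (fun v hrv W' hW' hv => by
      refine occ_mul_sum_le hl hx0 hx1 hdx hlam hdeg _ W' rfl v hv ?_
      have hlt : ({w ∈ W' | G.Adj v w} : Finset V) ⊂ Finset.univ.filter (G.Adj v) := by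
        refine (Finset.ssubset_iff_of_subset
          (Finset.filter_subset_filter _ (Finset.subset_univ _))).2 ⟨r, ?_, ?_⟩
        · simpa using hrv.symm
        · intro h
          have := hW' (Finset.mem_filter.1 h).1
          simp at this
      have := Finset.card_lt_card hlt
      have := hdeg v
      omega)
  have hcard : (({v ∈ U | G.Adj r v} : Finset V).card : ℝ) ≤ d + 1 := by
    exact_mod_cast (Finset.card_le_card
      (Finset.filter_subset_filter _ (Finset.subset_univ U))).trans (hdeg r)
  calc _ ≤ _ := hsum
    _ ≤ 1 + ∑ v ∈ U with G.Adj r v, x / (1 - d * x) := by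
        gcongr with v
        exact min_le_left _ _
    _ = 1 + ({v ∈ U | G.Adj r v} : Finset V).card * (x / (1 - d * x)) := by simp
    _ ≤ 1 + (d + 1) * (x / (1 - d * x)) := by gcongr
    _ = _ := by field_simp; ring

end Induced

/-! ### Conditional distributions of the Gibbs measure -/

section Conditional

variable {V : Type*} [Fintype V] {G : SimpleGraph V} {lam : ℝ}

lemma mem_occupied {σ : V → Bool} {v : V} : v ∈ occupied σ ↔ σ v = true := by
  simp [occupied]

lemma weight_nonneg (hl : 0 < lam) (σ : V → Bool) : 0 ≤ weight G lam σ := by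
  unfold weight; positivity

lemma partitionFunction_pos (hl : 0 < lam) : 0 < partitionFunction G lam := by
  classical
  refine Finset.sum_pos' (fun σ _ => weight_nonneg hl σ) ⟨fun _ => false, Finset.mem_univ _, ?_⟩
  have : occupied (fun _ : V => false) = ∅ := by ext; simp [occupied]
  simp [weight, this, SimpleGraph.IsIndepSet]

open Classical in
lemma gibbs_apply (hl : 0 < lam) (A : Set (V → Bool)) :
    gibbs G lam A = ENNReal.ofReal ((∑ σ with σ ∈ A, weight G lam σ) / partitionFunction G lam) := by
  have hZ := partitionFunction_pos (G := G) hl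
  unfold gibbs
  rw [Finset.sum_div, ENNReal.ofReal_sum_of_nonneg fun σ _ => div_nonneg (weight_nonneg hl σ) hZ.le,
    Measure.finsetSum_apply, Finset.sum_filter]
  refine Finset.sum_congr rfl fun σ _ => ?_
  rw [Measure.smul_apply, Measure.dirac_apply' _ (Set.toFinite A).measurableSet, smul_eq_mul]
  by_cases h : σ ∈ A <;> simp [h]

instance [Fact (0 < lam)] : IsFiniteMeasure (gibbs G lam) :=
  ⟨by rw [gibbs_apply Fact.out]; exact ENNReal.ofReal_lt_top⟩

open Classical in
lemma gibbs_real (hl : 0 < lam) (A : Set (V → Bool)) :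
    (gibbs G lam).real A = (∑ σ with σ ∈ A, weight G lam σ) / partitionFunction G lam := by
  rw [measureReal_def, gibbs_apply hl, ENNReal.toReal_ofReal]
  exact div_nonneg (Finset.sum_nonneg fun σ _ => weight_nonneg hl σ) (partitionFunction_pos hl).le

lemma exists_indep_of_gibbs_pos (hl : 0 < lam) {A : Set (V → Bool)} (h : 0 < gibbs G lam A) :
    ∃ σ ∈ A, G.IsIndepSet (occupied σ : Set V) := by
  classical
  by_contra! hA
  rw [gibbs_apply hl, Finset.sum_eq_zero, zero_div, ENNReal.ofReal_zero] at h
  · exact lt_irrefl _ h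
  · intro σ hσ
    exact if_neg (hA σ (Finset.mem_filter.1 hσ).2)

open Classical in
/-- The vertices occupied by a pinning. -/
def pinned (S : Set V) (τ : S → Bool) : Finset V := {v | ∃ h : v ∈ S, τ ⟨v, h⟩ = true}

open Classical in
/-- The vertices whose spin is not determined by a pinning. -/
def free (G : SimpleGraph V) (S : Set V) (τ : S → Bool) : Finset V :=
  {v | v ∉ S ∧ ∀ w ∈ pinned S τ, ¬ G.Adj w v}

lemma mem_pinned {S : Set V} {τ : S → Bool} {v : V} :
    v ∈ pinned S τ ↔ ∃ h : v ∈ S, τ ⟨v, h⟩ = true := by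
  simp [pinned]

lemma mem_free {S : Set V} {τ : S → Bool} {v : V} :
    v ∈ free G S τ ↔ v ∉ S ∧ ∀ w ∈ pinned S τ, ¬ G.Adj w v := by
  simp [free]

lemma pinned_subset_occupied {S : Set V} {τ : S → Bool} {σ : V → Bool} (hσ : σ ∈ pinEvent S τ) :
    pinned S τ ⊆ occupied σ := by
  intro v hv
  obtain ⟨h, hτ⟩ := mem_pinned.1 hv
  rw [mem_occupied, ← hτ]
  exact hσ ⟨v, h⟩

open Classical in
/-- Up to a constant factor, the conditional distribution given a pinning is the hardcore model on
the free vertices. -/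
lemma sum_pinEvent {S : Set V} {τ : S → Bool} (hS : G.IsIndepSet (pinned S τ : Set V))
    (f : Finset V → ℝ) :
    ∑ σ with σ ∈ pinEvent S τ, weight G lam σ * f (occupied σ \ pinned S τ) =
      lam ^ (pinned S τ).card * indepSum G lam (free G S τ) f := by
  unfold indepSum weight
  simp only [ite_mul, zero_mul]
  rw [Finset.mul_sum, ← Finset.sum_filter, Finset.filter_filter]
  refine Finset.sum_nbij' (fun σ => occupied σ \ pinned S τ)
    (fun I v => decide (v ∈ I ∪ pinned S τ)) ?_ ?_ ?_ ?_ ?_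
  · intro σ hσ
    simp only [Finset.mem_filter, Finset.mem_univ, true_and, Finset.mem_powerset] at hσ ⊢
    obtain ⟨hσ, hI⟩ := hσ
    refine ⟨fun v hv => ?_, fun a ha b hb => hI (Finset.sdiff_subset ha) (Finset.sdiff_subset hb)⟩
    obtain ⟨hv, hvp⟩ := Finset.mem_sdiff.1 hv
    refine mem_free.2 ⟨fun hvS => hvp (mem_pinned.2 ⟨hvS, ?_⟩), fun w hw => ?_⟩
    · rw [← mem_occupied.1 hv]; exact (hσ ⟨v, hvS⟩).symm
    · exact hI (pinned_subset_occupied hσ hw) hv fun h => hvp (h ▸ hw)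
  · intro I hI
    simp only [Finset.mem_filter, Finset.mem_univ, true_and, Finset.mem_powerset] at hI ⊢
    obtain ⟨hIU, hI⟩ := hI
    have hocc : occupied (fun v => decide (v ∈ I ∪ pinned S τ)) = I ∪ pinned S τ := by
      ext v; rw [mem_occupied, decide_eq_true_iff]
    refine ⟨fun v => ?_, ?_⟩
    · have h1 : v.1 ∉ I := fun h => (mem_free.1 (hIU h)).1 v.2
      have h2 : v.1 ∈ pinned S τ ↔ τ v = true := by rw [mem_pinned]; simp
      rw [Bool.eq_iff_iff, decide_eq_true_iff, Finset.mem_union, h2]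
      simp [h1]
    · rw [hocc]
      intro a ha b hb hab
      rcases Finset.mem_union.1 (Finset.mem_coe.1 ha) with ha | ha <;>
        rcases Finset.mem_union.1 (Finset.mem_coe.1 hb) with hb | hb
      · exact hI ha hb hab
      · exact fun h => (mem_free.1 (hIU ha)).2 b hb h.symm
      · exact (mem_free.1 (hIU hb)).2 a ha
      · exact hS ha hb hab
  · intro σ hσ
    simp only [Finset.mem_filter, Finset.mem_univ, true_and] at hσ
    funext v
    rw [Finset.sdiff_union_of_subset (pinned_subset_occupied hσ.1), Bool.eq_iff_iff,
      decide_eq_true_iff, mem_occupied]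
  · intro I hI
    simp only [Finset.mem_filter, Finset.mem_powerset] at hI
    ext v
    rw [Finset.mem_sdiff, mem_occupied, decide_eq_true_iff, Finset.mem_union]
    have : v ∈ I → v ∉ pinned S τ := fun h hp =>
      (mem_free.1 (hI.1 h)).1 (mem_pinned.1 hp).1
    tauto
  · intro σ hσ
    simp only [Finset.mem_filter, Finset.mem_univ, true_and] at hσ
    rw [← mul_assoc, ← pow_add, ← Finset.card_sdiff_add_card_eq_card (pinned_subset_occupied hσ.1)]
    ring

-- The prefactor does not depend on `f`, so it cancels in every conditional probability.
open Classical in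
lemma gibbs_real_pinEvent_inter (hl : 0 < lam) {S : Set V} {τ : S → Bool}
    (hS : G.IsIndepSet (pinned S τ : Set V)) (f : Finset V → ℝ) {A : Set (V → Bool)}
    (hA : ∀ σ ∈ pinEvent S τ, f (occupied σ \ pinned S τ) = if σ ∈ A then 1 else 0) :
    (gibbs G lam).real (pinEvent S τ ∩ A) =
      lam ^ (pinned S τ).card / partitionFunction G lam * indepSum G lam (free G S τ) f := by
  rw [gibbs_real hl, div_mul_eq_mul_div, ← sum_pinEvent hS]
  congr 1
  simp only [Finset.sum_filter]
  refine Finset.sum_congr rfl fun σ _ => ?_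
  by_cases h : σ ∈ pinEvent S τ
  · simp [h, hA σ h]
  · simp [h]

/-- A vertex of `S` has a constant spin, and a neighbour of an occupied pin cannot be occupied. This
inclusion suffices, since row sums are only bounded above. -/
lemma mem_free_of_mem_unfixed (hl : 0 < lam) {S : Set V} {τ : S → Bool} {i : V}
    (hi : i ∈ unfixed ((gibbs G lam)[|pinEvent S τ])) : i ∈ free G S τ := by
  have key : ∀ b, 0 < (gibbs G lam)[|pinEvent S τ] (spinEvent i b) →
      ∃ σ ∈ pinEvent S τ, σ i = b ∧ G.IsIndepSet (occupied σ : Set V) := by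
    intro b hb
    rw [cond_apply (Set.toFinite _).measurableSet] at hb
    obtain ⟨σ, hσ, hI⟩ := exists_indep_of_gibbs_pos hl (pos_iff_ne_zero.2 (right_ne_zero_of_mul hb.ne'))
    exact ⟨σ, hσ.1, hσ.2, hI⟩
  obtain ⟨σ, hσ, hσi, -⟩ := key false hi.1
  obtain ⟨ρ, hρ, hρi, hI⟩ := key true hi.2
  refine mem_free.2 ⟨fun h => ?_, fun w hw hwi => ?_⟩
  · have h1 := hσ ⟨i, h⟩
    have h2 := hρ ⟨i, h⟩
    simp only at h1 h2
    rw [← h1, hσi, hρi] at h2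
    cases h2
  · exact hI (pinned_subset_occupied hρ hw) (mem_occupied.2 hρi) hwi.ne hwi

lemma influence_eq (hl : 0 < lam) {S : Set V} {τ : S → Bool}
    (hpos : 0 < gibbs G lam (pinEvent S τ))
    (i j : unfixed ((gibbs G lam)[|pinEvent S τ])) :
    influence ((gibbs G lam)[|pinEvent S τ]) i j = subInfluence G lam (free G S τ) i j := by
  classical
  have : Fact (0 < lam) := ⟨hl⟩
  have hi := mem_free_of_mem_unfixed hl i.2
  have hj := mem_free_of_mem_unfixed hl j.2
  have hS : G.IsIndepSet (pinned S τ : Set V) := by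
    obtain ⟨σ, hσ, hI⟩ := exists_indep_of_gibbs_pos hl hpos
    exact fun a ha b hb => hI (pinned_subset_occupied hσ ha) (pinned_subset_occupied hσ hb)
  have hspin : ∀ v ∈ free G S τ, ∀ σ : V → Bool, v ∈ occupied σ \ pinned S τ ↔ σ v = true := by
    intro v hv σ
    rw [Finset.mem_sdiff, mem_occupied, and_iff_left]
    exact fun h => (mem_free.1 hv).1 (mem_pinned.1 h).1
  have hm : ∀ A : Set (V → Bool), MeasurableSet A := fun A => (Set.toFinite A).measurableSet
  have hcond : ∀ b, ((gibbs G lam)[|pinEvent S τ][|spinEvent i.1 b]).real (spinEvent j.1 true) =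
      (gibbs G lam).real (pinEvent S τ ∩ (spinEvent i.1 b ∩ spinEvent j.1 true)) /
        (gibbs G lam).real (pinEvent S τ ∩ spinEvent i.1 b) := by
    intro b
    rw [cond_cond_eq_cond_inter (hm _) (hm _), measureReal_def, cond_apply (hm _),
      ENNReal.toReal_mul, ENNReal.toReal_inv, ← Set.inter_assoc, div_eq_inv_mul]
    rfl
  have hK : lam ^ (pinned S τ).card / partitionFunction G lam ≠ 0 :=
    (div_pos (pow_pos hl _) (partitionFunction_pos hl)).ne'
  unfold influence
  -- The four test functions are the indicators of `{i, j}` occupied, `i` occupied, `j` but not `i`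
  -- occupied, and `i` empty.
  rw [hcond, hcond,
    gibbs_real_pinEvent_inter hl hS (fun I => if i.1 ∈ I then (if j.1 ∈ I then 1 else 0) else 0),
    gibbs_real_pinEvent_inter hl hS (fun I => if i.1 ∈ I then 1 else 0),
    gibbs_real_pinEvent_inter hl hS (fun I => if i.1 ∈ I then 0 else (if j.1 ∈ I then 1 else 0)),
    gibbs_real_pinEvent_inter hl hS (fun I => if i.1 ∈ I then 0 else 1),
    mul_div_mul_left _ _ hK, mul_div_mul_left _ _ hK, sum_indep_notMem, sum_indep_notMem,
    sum_indep_mem hi (fun I => if j.1 ∈ I then 1 else 0), sum_indep_mem hi (fun _ => 1),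
    mul_div_mul_left _ _ hl.ne']
  · unfold subInfluence
    congr 1
    · split_ifs with h
      · rw [h]
        simp only [Finset.mem_insert_self, if_true]
        exact div_self (subZ_pos hl _).ne'
      · simp only [Finset.mem_insert, h, false_or]
        rfl
  all_goals
    intro σ _
    simp only [hspin _ hi, hspin _ hj, spinEvent, Set.mem_inter_iff, Set.mem_ofPred_eq]
    rcases Bool.eq_false_or_eq_true (σ i.1) with h | h <;> simp [h]

/-- Spectral independence of the hardcore model at a fixed point `x` of the tree recursion with
`d x < 1`. -/
lemma linftySpectralIndependence_gibbs {d : ℕ} {x : ℝ} (hl : 0 < lam) (hx0 : 0 < x) (hx1 : x < 1)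
    (hdx : d * x < 1) (hlam : lam * (1 - x) ^ (d + 1) = x) [DecidableRel G.Adj]
    (hdeg : G.maxDegree ≤ d + 1) :
    LinftySpectralIndependence (gibbs G lam) ((1 + x) / (1 - d * x)) := by
  classical
  intro S τ hpos
  -- Nonnegativity of the constant covers the case of no unfixed coordinates, where the supremum is
  -- `0`.
  refine Real.iSup_le (fun i => ?_) (div_nonneg (by linarith) (by linarith))
  simp only [influence_eq hl hpos]
  refine le_trans ?_ (sum_abs_subInfluence_le (G := G) hl hx0 hx1 hdx hlam (fun v => ?_)
    (mem_free_of_mem_unfixed hl i.2))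
  -- The row over unfixed coordinates is enlarged to a sum over all of `V`.
  · rw [← Finset.sum_image (f := fun j => |subInfluence G lam (free G S τ) i j|)
      (g := fun j : unfixed ((gibbs G lam)[|pinEvent S τ]) => (j : V)) (fun _ _ _ _ h => Subtype.ext h)]
    exact Finset.sum_le_sum_of_subset_of_nonneg (Finset.subset_univ _) fun _ _ _ => abs_nonneg _
  · refine le_trans (le_of_eq ?_) ((G.degree_le_maxDegree v).trans hdeg)
    rw [← SimpleGraph.card_neighborFinset_eq_degree, SimpleGraph.neighborFinset_eq_filter]
    congr!

end Conditional

end Hardcore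

end

theorem mainTheorem2 (Δ d : ℕ) (hΔd : Δ = d + 1) (hΔ : 3 ≤ Δ)
    (δ : ℝ) (hδ0 : 0 < δ) (hδ1 : δ < 1)
    (lam : ℝ) (hlam : lam = (1 - δ) * Hardcore.criticalFugacity Δ) :
    ∃ xhat ∈ Set.Ioo (0 : ℝ) (1 / (d : ℝ)),
      Hardcore.treeRecursion d lam xhat = xhat ∧
      (∀ y ∈ Set.Icc (0 : ℝ) 1, Hardcore.treeRecursion d lam y = y → y = xhat) ∧
      (∀ (V : Type*) [Fintype V] (G : SimpleGraph V) [DecidableRel G.Adj], G.maxDegree ≤ Δ →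
        Hardcore.LinftySpectralIndependence (Hardcore.gibbs G lam)
          ((1 + xhat) / (1 - (d : ℝ) * xhat))) ∧
      (1 + xhat) / (1 - (d : ℝ) * xhat) ≤ 2 / δ * (1 + 2 / ((d : ℝ) - 1)) := by
  subst hΔd
  have hd : 2 ≤ d := by omega
  have hd' : (2 : ℝ) ≤ d := by exact_mod_cast hd
  have hc : 0 < Hardcore.criticalFugacity (d + 1) := by
    rw [Hardcore.criticalFugacity_succ]
    have : (0 : ℝ) < d - 1 := by linarith
    positivity
  have hl : 0 < lam := hlam ▸ mul_pos (by linarith) hc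
  obtain ⟨x, hx, hfx⟩ := Hardcore.exists_fixedPoint hd hl (by rw [hlam]; nlinarith)
  have hdx : d * x < 1 := by
    have := hx.2
    rw [lt_div_iff₀ (by positivity)] at this
    linarith
  have hx1 : x < 1 := by nlinarith [hx.1]
  exact ⟨x, hx, (Hardcore.treeRecursion_eq_iff hl hx1.le).2 hfx,
    fun y hy h => Hardcore.fixedPoint_unique hl hx1.le hy.2 hfx
      ((Hardcore.treeRecursion_eq_iff hl hy.2).1 h),
    fun V _ G _ hG => Hardcore.linftySpectralIndependence_gibbs hl hx.1 hx1 hdx hfx hG,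
    Hardcore.constant_le hd hδ0 hlam hx hfx⟩
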